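/- Let $\mathcal C\subset[0,1]$ be the ternary Cantor set, let $\mathcal C^d=\{(x_1,\dots,x_d)\in\mathbb R^d : x_i\in\mathcal C \text{ for all } i\}$, and let $s_d=d\log_3 2$. Let $\mathcal H^s$ denote the $s$-dimensional Hausdorff measure on $\mathbb R^d$ with the Euclidean metric, normalised as $$\mathcal H^s(F)=\lim_{\delta\to0}\inf\Big\{\sum_{i=1}^\infty|U_i|^s : |U_i|\le\delta \text{ for all } i,\ F\subset\bigcup_{i=1}^\infty U_i\Big\},$$ where $|U|$ is the diameter of $U$. Then $$\mathcal H^{s_3}(\mathcal C^3) > \left(\frac{2\sqrt{26}}{9}\right)^{3\log_3 2} \ge 1.266862 .$$ Moreover $$\mathcal H^{s_3}(\mathcal C^3) > 1.811621 \qquad\text{and}\qquad \mathcal H^{s_3}(\mathcal C^3) > \mathcal H^{s_2}(\mathcal C^2).$$ -/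

import Mathlib

/-- The `d`-fold product of the ternary Cantor set, as a subset of Euclidean space `ℝᵈ`
(with the Euclidean metric, which is the one used for diameters). -/
def cantorProduct (d : ℕ) : Set (EuclideanSpace ℝ (Fin d)) :=
  {x | ∀ i, x i ∈ cantorSet}

/-- The exponent `d * log₃ 2`. -/
noncomputable def cantorExponent (d : ℕ) : ℝ := (d : ℝ) * Real.logb 3 2

/-!
The lower bound is a mass distribution argument: the natural probability measure `μ` on `𝒞³`
satisfies `1.812 * μ U ≤ (diam U) ^ s₃` for every bounded set `U`.

A set which charges only one of the eight subcubes of side `1 / 3` can be magnified by `3`; this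
multiplies both sides of the inequality by `8`. So it suffices to treat sets which charge at least
two subcubes, whose diameter `δ` is at least `1 / 3`, and `δ ≤ 1.39`, since beyond that
`1.812 ≤ δ ^ s₃`.

If `U` meets the subcubes at two corners of the cube which differ in `k` coordinates, rescale the
two parts to the unit cube. By the Cauchy–Schwarz inequality the `ℓ¹`-distances, in these `k`
coordinates, of their points to the respective corners add up to at least `3 * (k - √k * δ)`. The
masses of the two parts are thus bounded by tail probabilities of sums of `k` independent random
points of `𝒞`. Pairs of corners at distances `1`, `2` and `3` combine to a bound for the total mass,
which increases with `δ` and therefore has to be compared with `δ ^ s₃` only along a finite chain of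
scales.

The planar measure is at most `√2 ^ s₂ < 1.812`, by covering with the pieces of generation `n`.
-/

open MeasureTheory ProbabilityTheory Filter Topology
open scoped ENNReal Finset

section ShiftInvariance

variable {X : Type*}

/-- The sequence `a, ω 0, ω 1, …`. -/
def consSeq (a : X) (ω : ℕ → X) : ℕ → X
  | 0 => a
  | n + 1 => ω n

theorem consSeq_mem_pi_iff {a : X} {ω : ℕ → X} {s : Set ℕ} {t : ℕ → Set X} :
    consSeq a ω ∈ s.pi t ↔ (0 ∈ s → a ∈ t 0) ∧ ω ∈ (Nat.succ ⁻¹' s).pi fun n => t (n + 1) := by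
  simp only [Set.mem_pi]
  exact ⟨fun h => ⟨h 0, fun n => h (n + 1)⟩, fun h n => by
    cases n with
    | zero => exact h.1
    | succ n => exact h.2 n⟩

theorem prod_eq_ite_mul_prod_preimage_succ {M : Type*} [CommMonoid M] (s : Finset ℕ) (f : ℕ → M) :
    ∏ n ∈ s, f n = (if 0 ∈ s then f 0 else 1) *
      ∏ n ∈ s.preimage Nat.succ Nat.succ_injective.injOn, f (n + 1) := by
  have hprod : ∏ n ∈ s.preimage Nat.succ Nat.succ_injective.injOn, f (n + 1) =
      ∏ n ∈ s with n ≠ 0, f n := by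
    classical
    rw [Finset.prod_preimage' Nat.succ s Nat.succ_injective.injOn f]
    simp only [Set.mem_range, Nat.succ_eq_add_one, Nat.exists_add_one_eq, Nat.pos_iff_ne_zero]
  rw [hprod, ← Finset.prod_filter_mul_prod_filter_not s (· = 0), Finset.filter_eq']
  split_ifs <;> simp

variable [MeasurableSpace X]

theorem measurable_consSeq : Measurable fun p : X × (ℕ → X) => consSeq p.1 p.2 := by
  refine measurable_pi_lambda _ fun n => ?_
  cases n with
  | zero => exact measurable_fst
  | succ n => exact (measurable_pi_apply n).comp measurable_snd

theorem map_consSeq_prod_infinitePi (P : Measure X) [IsProbabilityMeasure P] :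
    (P.prod (Measure.infinitePi fun _ : ℕ => P)).map (fun p => consSeq p.1 p.2) =
      Measure.infinitePi fun _ : ℕ => P := by
  classical
  refine Measure.eq_infinitePi (μ := fun _ : ℕ => P) fun s t ht => ?_
  have hpre : (fun p : X × (ℕ → X) => consSeq p.1 p.2) ⁻¹' (s : Set ℕ).pi t =
      {a | 0 ∈ s → a ∈ t 0} ×ˢ
        ((s.preimage Nat.succ Nat.succ_injective.injOn : Finset ℕ) : Set ℕ).pi
          fun n => t (n + 1) := by
    ext p
    simp only [Set.mem_preimage, consSeq_mem_pi_iff, Set.mem_prod, Finset.coe_preimage,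
      Finset.mem_coe, Set.mem_ofPred_eq]
  have hhead : P {a | 0 ∈ s → a ∈ t 0} = if 0 ∈ s then P (t 0) else 1 := by
    split_ifs with h <;> simp [h]
  rw [Measure.map_apply measurable_consSeq (.pi s.countable_toSet fun n _ => ht n), hpre,
    Measure.prod_prod, hhead, Measure.infinitePi_pi _ fun n _ => ht (n + 1),
    prod_eq_ite_mul_prod_preimage_succ s]

end ShiftInvariance

section CantorMeasure

variable {d : ℕ}

/-- The similarity of ratio `1 / 3` which maps the unit cube onto its subcube at the corner `b`;
a corner is encoded by the coordinates (`true`) in which it is `1` rather than `0`. -/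
noncomputable def cornerMap (b : Fin d → Bool) (x : EuclideanSpace ℝ (Fin d)) :
    EuclideanSpace ℝ (Fin d) :=
  WithLp.toLp 2 fun l => ((if b l then 2 else 0) + x l) / 3

@[simp]
theorem cornerMap_apply (b : Fin d → Bool) (x : EuclideanSpace ℝ (Fin d)) (l : Fin d) :
    cornerMap b x l = ((if b l then 2 else 0) + x l) / 3 :=
  rfl

theorem continuous_cornerMap (b : Fin d → Bool) : Continuous (cornerMap b) := by
  unfold cornerMap
  fun_prop

theorem dist_cornerMap (b : Fin d → Bool) (x y : EuclideanSpace ℝ (Fin d)) :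
    dist (cornerMap b x) (cornerMap b y) = dist x y / 3 := by
  have hsub : cornerMap b x - cornerMap b y = (3 : ℝ)⁻¹ • (x - y) := by
    ext l
    simp only [PiLp.sub_apply, cornerMap_apply, PiLp.smul_apply, smul_eq_mul]
    ring
  rw [dist_eq_norm, hsub, norm_smul, ← dist_eq_norm, norm_inv, Real.norm_ofNat]
  ring

/-- The point of the Cantor product whose `n`-th ternary digit in the coordinate `l` is `2` or `0`
according to the bit `ω n l`. -/
noncomputable def addressPoint (ω : ℕ → Fin d → Bool) : EuclideanSpace ℝ (Fin d) :=
  WithLp.toLp 2 fun l => Real.ofDigits fun n => cond (ω n l) (2 : Fin 3) 0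

theorem addressPoint_mem_cantorProduct (ω : ℕ → Fin d → Bool) :
    addressPoint ω ∈ cantorProduct d :=
  fun l => ofDigits_bool_to_fin_three_mem_cantorSet fun n => ω n l

theorem measurable_addressPoint : Measurable (addressPoint (d := d)) := by
  refine (MeasurableEquiv.toLp 2 (Fin d → ℝ)).measurable.comp (measurable_pi_lambda _ fun l => ?_)
  refine Real.continuous_ofDigits.measurable.comp (measurable_pi_lambda _ fun n => ?_)
  exact (measurable_of_finite fun b : Fin d → Bool => cond (b l) (2 : Fin 3) 0).comp
    (measurable_pi_apply n)

theorem addressPoint_consSeq (b : Fin d → Bool) (ω : ℕ → Fin d → Bool) :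
    addressPoint (consSeq b ω) = cornerMap b (addressPoint ω) := by
  ext l
  simp only [addressPoint, cornerMap_apply]
  rw [Real.ofDigits_eq_sum_add_ofDigits _ 1]
  cases hb : b l <;> simp [Real.ofDigitsTerm, consSeq, hb] <;> ring

instance : IsProbabilityMeasure (uniformOn (Set.univ : Set (Fin d → Bool))) :=
  isProbabilityMeasure_uniformOn Set.finite_univ Set.univ_nonempty

/-- The natural probability measure on the Cantor product: the law of a point with independent
fair ternary digits in `{0, 2}`. -/
noncomputable def cantorMeasure (d : ℕ) : Measure (EuclideanSpace ℝ (Fin d)) :=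
  (Measure.infinitePi fun _ : ℕ => uniformOn (Set.univ : Set (Fin d → Bool))).map addressPoint

instance : IsProbabilityMeasure (cantorMeasure d) :=
  Measure.isProbabilityMeasure_map measurable_addressPoint.aemeasurable

theorem measurable_uncurry_cornerMap :
    Measurable fun p : (Fin d → Bool) × EuclideanSpace ℝ (Fin d) => cornerMap p.1 p.2 :=
  measurable_from_prod_countable_right fun b => (continuous_cornerMap b).measurable

theorem cantorMeasure_eq_map_prod :
    cantorMeasure d = ((uniformOn (Set.univ : Set (Fin d → Bool))).prod (cantorMeasure d)).map
      fun p => cornerMap p.1 p.2 := by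
  set P : Measure (Fin d → Bool) := uniformOn Set.univ
  have hprod : P.prod (cantorMeasure d) =
      (P.prod (Measure.infinitePi fun _ : ℕ => P)).map (Prod.map id addressPoint) := by
    rw [← Measure.map_prod_map _ _ measurable_id measurable_addressPoint, Measure.map_id,
      cantorMeasure]
  have hcons : cantorMeasure d = (P.prod (Measure.infinitePi fun _ : ℕ => P)).map
      (addressPoint ∘ fun p => consSeq p.1 p.2) := by
    rw [← Measure.map_map measurable_addressPoint measurable_consSeq,
      map_consSeq_prod_infinitePi, cantorMeasure]
  rw [hprod, Measure.map_map measurable_uncurry_cornerMap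
    (measurable_id.prodMap measurable_addressPoint), hcons]
  congr 1
  ext1 p
  exact addressPoint_consSeq p.1 p.2

theorem cantorMeasure_real_eq_sum {U : Set (EuclideanSpace ℝ (Fin d))} (hU : MeasurableSet U) :
    (cantorMeasure d).real U =
      (∑ b : Fin d → Bool, (cantorMeasure d).real (cornerMap b ⁻¹' U)) / 2 ^ d := by
  have hsum : cantorMeasure d U =
      ∑ b : Fin d → Bool, cantorMeasure d (cornerMap b ⁻¹' U) * (2 ^ d)⁻¹ := by
    conv_lhs => rw [cantorMeasure_eq_map_prod, Measure.map_apply measurable_uncurry_cornerMap hU,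
      Measure.prod_apply (measurable_uncurry_cornerMap hU), lintegral_fintype]
    refine Finset.sum_congr rfl fun b _ => ?_
    rw [uniformOn_univ, Measure.count_singleton]
    simp [Set.preimage_preimage]
  rw [measureReal_def, hsum, ENNReal.toReal_sum fun b _ =>
    ENNReal.mul_ne_top (measure_ne_top _ _) (by simp), Finset.sum_div]
  simp [measureReal_def, div_eq_mul_inv]

theorem isClosed_cantorProduct : IsClosed (cantorProduct d) := by
  simp only [cantorProduct, Set.ofPred_forall]
  exact isClosed_iInter fun l => isClosed_cantorSet.preimage (by fun_prop)

theorem cantorMeasure_cantorProduct : cantorMeasure d (cantorProduct d) = 1 := by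
  rw [cantorMeasure, Measure.map_apply measurable_addressPoint isClosed_cantorProduct.measurableSet,
    Set.eq_univ_of_forall (s := addressPoint ⁻¹' _) addressPoint_mem_cantorProduct, measure_univ]

/-- The closed unit cube `[0, 1]ᵈ`. -/
def unitCube (d : ℕ) : Set (EuclideanSpace ℝ (Fin d)) := {x | ∀ l, x l ∈ Set.Icc (0 : ℝ) 1}

theorem cantorProduct_subset_unitCube : cantorProduct d ⊆ unitCube d :=
  fun _ hx l => cantorSet_subset_unitInterval (hx l)

theorem cantorMeasure_real_inter_unitCube (U : Set (EuclideanSpace ℝ (Fin d))) :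
    (cantorMeasure d).real (U ∩ unitCube d) = (cantorMeasure d).real U := by
  have hnull : cantorMeasure d (cantorProduct d)ᶜ = 0 :=
    (prob_compl_eq_zero_iff isClosed_cantorProduct.measurableSet).2 cantorMeasure_cantorProduct
  rw [measureReal_def, measureReal_def, measure_inter_conull
    (measure_mono_null (Set.compl_subset_compl.2 cantorProduct_subset_unitCube) hnull)]

end CantorMeasure

section CornerDist

variable {d : ℕ}

/-- The `ℓ¹`-distance, in the coordinates belonging to `D`, of a point `x` of the unit cube to the
corner `b`. -/
noncomputable def cornerDist (D : Finset (Fin d)) (b : Fin d → Bool)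
    (x : EuclideanSpace ℝ (Fin d)) : ℝ :=
  ∑ l ∈ D, if b l then 1 - x l else x l

variable (D : Finset (Fin d)) (b : Fin d → Bool)

theorem continuous_cornerDist : Continuous (cornerDist D b) := by
  refine continuous_finsetSum _ fun l _ => ?_
  split_ifs <;> fun_prop

theorem measurableSet_le_cornerDist (a : ℝ) : MeasurableSet {y | a ≤ cornerDist D b y} :=
  (isClosed_le continuous_const (continuous_cornerDist D b)).measurableSet

variable {x : EuclideanSpace ℝ (Fin d)}

theorem cornerDist_nonneg (hx : x ∈ unitCube d) : 0 ≤ cornerDist D b x := by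
  refine Finset.sum_nonneg fun l _ => ?_
  split_ifs
  exacts [sub_nonneg.2 (hx l).2, (hx l).1]

theorem cornerDist_le_card (hx : x ∈ unitCube d) : cornerDist D b x ≤ #D := by
  refine (Finset.sum_le_card_nsmul D _ 1 fun l _ => ?_).trans_eq (nsmul_one _)
  split_ifs
  exacts [sub_le_self 1 (hx l).1, (hx l).2]

theorem cornerDist_cornerMap (b' : Fin d → Bool) (x : EuclideanSpace ℝ (Fin d)) :
    cornerDist D b (cornerMap b' x) =
      (2 * (#{l ∈ D | b' l ≠ b l} : ℝ) + cornerDist D b x) / 3 := by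
  rw [Finset.card_filter]
  push_cast
  rw [cornerDist, cornerDist, Finset.mul_sum, ← Finset.sum_add_distrib, Finset.sum_div]
  refine Finset.sum_congr rfl fun l _ => ?_
  rw [cornerMap_apply]
  cases b l <;> cases b' l <;> simp <;> ring

end CornerDist

section TailMass

variable {d : ℕ}

theorem sum_corner_eq_sum_powerset (D : Finset (Fin d)) (b : Fin d → Bool) (f : ℕ → ℝ) :
    ∑ b' : Fin d → Bool, f #{l ∈ D | b' l ≠ b l} =
      ∑ p ∈ D.powerset ×ˢ Dᶜ.powerset, f #p.1 := by
  refine Finset.sum_bij'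
    (fun b' _ => (({l ∈ D | b' l ≠ b l} : Finset (Fin d)), ({l ∈ Dᶜ | b' l ≠ b l} : Finset _)))
    (fun p _ l => xor (b l) (l ∈ p.1 ∪ p.2)) ?_ ?_ ?_ ?_ ?_
  · intro b' _
    simp only [Finset.mem_product, Finset.mem_powerset, Finset.filter_subset, and_self]
  · simp
  · intro b' _
    ext l
    by_cases hl : l ∈ D <;> cases hb : b l <;> cases hb' : b' l <;> simp [hl, hb, hb']
  · rintro ⟨s, t⟩ hst
    simp only [Finset.mem_product, Finset.mem_powerset] at hst
    have hs : ∀ l, l ∈ s → l ∈ D := fun l => @hst.1 l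
    have ht : ∀ l, l ∈ t → l ∉ D := fun l hl => by simpa using hst.2 hl
    ext l <;> specialize hs l <;> specialize ht l <;> cases hb : b l <;> simp [hb] <;> tauto
  · simp

theorem sum_corner_eq_sum_choose (D : Finset (Fin d)) (b : Fin d → Bool) (f : ℕ → ℝ) :
    ∑ b' : Fin d → Bool, f #{l ∈ D | b' l ≠ b l} =
      2 ^ (d - #D) * ∑ j ∈ Finset.range (#D + 1), (#D).choose j * f j := by
  rw [sum_corner_eq_sum_powerset, Finset.sum_product]
  simp only [Finset.sum_const, Finset.card_powerset, Finset.card_compl, Fintype.card_fin]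
  rw [← Finset.smul_sum, Finset.sum_powerset_apply_card]
  simp only [nsmul_eq_mul, Nat.cast_pow, Nat.cast_ofNat]

/-- A computable upper bound for the probability that the sum of `k` independent random points of
the Cantor set is at least `x`; the recursion follows the first `n` ternary digits. -/
def tailMass (k : ℕ) : ℕ → ℚ → ℚ
  | 0, x => if x ≤ k then 1 else 0
  | n + 1, x =>
    if x ≤ 0 then 1 else if x ≤ k then
      (∑ j ∈ Finset.range (k + 1), k.choose j * tailMass k n (3 * x - 2 * j)) / 2 ^ k
    else 0

theorem preimage_cornerMap_le_cornerDist (D : Finset (Fin d)) (b b' : Fin d → Bool) (x : ℝ) :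
    cornerMap b' ⁻¹' {y | x ≤ cornerDist D b y} =
      {y | 3 * x - 2 * #{l ∈ D | b' l ≠ b l} ≤ cornerDist D b y} := by
  ext y
  simp only [Set.mem_preimage, Set.mem_ofPred_eq, cornerDist_cornerMap]
  constructor <;> intro h <;> linarith

theorem cantorMeasure_real_le_cornerDist_eq_zero (D : Finset (Fin d)) (b : Fin d → Bool) {x : ℝ}
    (hx : #D < x) : (cantorMeasure d).real {y | x ≤ cornerDist D b y} = 0 := by
  have hempty : {y | x ≤ cornerDist D b y} ∩ unitCube d = ∅ := by
    ext y
    simp only [Set.mem_inter_iff, Set.mem_ofPred_eq, Set.mem_empty_iff_false, iff_false, not_and]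
    exact fun hy hcube => (hy.trans (cornerDist_le_card D b hcube)).not_gt hx
  rw [← cantorMeasure_real_inter_unitCube, hempty, measureReal_empty]

theorem cantorMeasure_real_le_cornerDist_le_tailMass (D : Finset (Fin d)) (b : Fin d → Bool)
    (n : ℕ) (x : ℚ) :
    (cantorMeasure d).real {y | (x : ℝ) ≤ cornerDist D b y} ≤ tailMass #D n x := by
  have hzero : ∀ x : ℚ, ¬x ≤ #D → (cantorMeasure d).real {y | (x : ℝ) ≤ cornerDist D b y} = 0 :=
    fun x hx => cantorMeasure_real_le_cornerDist_eq_zero D b (by exact_mod_cast not_le.1 hx)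
  induction n generalizing x with
  | zero =>
    unfold tailMass
    split_ifs with hx
    · simp [measureReal_le_one]
    · simp [hzero x hx]
  | succ n ih =>
    unfold tailMass
    split_ifs with hx0 hx
    · simp [measureReal_le_one]
    · have hpow : (2 : ℝ) ^ d = 2 ^ (d - #D) * 2 ^ #D := by
        rw [← pow_add, Nat.sub_add_cancel (card_finset_fin_le D)]
      calc (cantorMeasure d).real {y | (x : ℝ) ≤ cornerDist D b y}
          ≤ (∑ b' : Fin d → Bool, (tailMass #D n (3 * x - 2 * #{l ∈ D | b' l ≠ b l}) : ℝ)) /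
              2 ^ d := by
            rw [cantorMeasure_real_eq_sum (measurableSet_le_cornerDist D b x)]
            gcongr with b' _
            rw [preimage_cornerMap_le_cornerDist]
            exact_mod_cast ih (3 * x - 2 * #{l ∈ D | b' l ≠ b l})
        _ = _ := by
            rw [sum_corner_eq_sum_choose D b fun j => (tailMass #D n (3 * x - 2 * j) : ℝ), hpow,
              mul_div_mul_left _ _ (by positivity)]
            push_cast
            rfl
    · simp [hzero x hx]

end TailMass

section PairMass

variable {d : ℕ}

theorem one_sub_add_le_abs_sub_cornerMap {b b' : Fin d → Bool} {l : Fin d} (hl : b l ≠ b' l)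
    (x y : EuclideanSpace ℝ (Fin d)) :
    3 - (if b l then 1 - x l else x l) - (if b' l then 1 - y l else y l) ≤
      3 * |cornerMap b x l - cornerMap b' y l| := by
  simp only [cornerMap_apply]
  cases hb : b l <;> cases hb' : b' l <;> simp_all only [ne_eq, not_true_eq_false] <;>
    simp only [Bool.false_eq_true, if_true, if_false]
  · linarith [neg_le_abs ((0 + x l) / 3 - (2 + y l) / 3)]
  · linarith [le_abs_self ((2 + x l) / 3 - (0 + y l) / 3)]

theorem sum_abs_sub_le_sqrt_card_mul_dist (D : Finset (Fin d)) (x y : EuclideanSpace ℝ (Fin d)) :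
    ∑ l ∈ D, |x l - y l| ≤ √(#D : ℝ) * dist x y := by
  refine (abs_le_of_sq_le_sq' ?_ (by positivity)).2
  calc (∑ l ∈ D, |x l - y l|) ^ 2 ≤ #D * ∑ l ∈ D, |x l - y l| ^ 2 := sq_sum_le_card_mul_sum_sq
    _ ≤ #D * ∑ l, |x l - y l| ^ 2 := by
      gcongr
      exact Finset.subset_univ D
    _ = (√(#D : ℝ) * dist x y) ^ 2 := by
      rw [mul_pow, Real.sq_sqrt (by positivity), EuclideanSpace.dist_eq,
        Real.sq_sqrt (by positivity)]
      rfl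

theorem sub_mul_dist_le_cornerDist_add_cornerDist (b b' : Fin d → Bool)
    (x y : EuclideanSpace ℝ (Fin d)) :
    3 * (hammingDist b b' - √(hammingDist b b') * dist (cornerMap b x) (cornerMap b' y)) ≤
      cornerDist {l | b l ≠ b' l} b x + cornerDist {l | b l ≠ b' l} b' y := by
  set D : Finset (Fin d) := {l | b l ≠ b' l} with hD
  have hcard : hammingDist b b' = #D := rfl
  have hsum := Finset.sum_le_sum fun l (hl : l ∈ D) =>
    one_sub_add_le_abs_sub_cornerMap (b := b) (b' := b') (l := l) (by simpa [hD] using hl) x y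
  rw [Finset.sum_sub_distrib, Finset.sum_sub_distrib, Finset.sum_const, nsmul_eq_mul,
    ← Finset.mul_sum] at hsum
  have hle := sum_abs_sub_le_sqrt_card_mul_dist D (cornerMap b x) (cornerMap b' y)
  rw [hcard, cornerDist, cornerDist]
  linarith

theorem sqrt_hammingDist_le_mul_dist {b b' : Fin d → Bool} (hb : b ≠ b')
    {x y : EuclideanSpace ℝ (Fin d)} (hx : x ∈ unitCube d) (hy : y ∈ unitCube d) :
    √(hammingDist b b') ≤ 3 * dist (cornerMap b x) (cornerMap b' y) := by
  have hpos : 0 < √(hammingDist b b' : ℝ) :=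
    Real.sqrt_pos.2 (Nat.cast_pos.2 (hammingDist_pos.2 hb))
  have hx' : _ ≤ (hammingDist b b' : ℝ) := cornerDist_le_card {l | b l ≠ b' l} b hx
  have hy' : _ ≤ (hammingDist b b' : ℝ) := cornerDist_le_card {l | b l ≠ b' l} b' hy
  have hsub := sub_mul_dist_le_cornerDist_add_cornerDist b b' x y
  have hsq := Real.sq_sqrt (Nat.cast_nonneg (α := ℝ) (hammingDist b b'))
  refine le_of_mul_le_mul_left ?_ hpos
  linarith

/-- A computable upper bound for the total mass of two sets such that the `ℓ¹`-distances, in `k`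
coordinates, of their points to two given corners always add up to at least `t`. The least distance
occurring in the first set is located on the grid of mesh `1 / q`; the condition on `j` holds
whenever the second set is nonempty. -/
def pairMass (k q n : ℕ) (t : ℚ) : ℚ :=
  (Finset.range (k * q + 1)).sup' Finset.nonempty_range_add_one fun j =>
    if t - (j + 1) / q < k then tailMass k n (j / q) + tailMass k n (t - (j + 1) / q) else 0

theorem exists_nat_div_le_cornerDist (D : Finset (Fin d)) (b : Fin d → Bool) {q : ℕ} (hq : 0 < q)
    {A : Set (EuclideanSpace ℝ (Fin d))} (hA : A ⊆ unitCube d) (hA₀ : A.Nonempty) :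
    ∃ j ≤ #D * q, (∀ x ∈ A, (j / q : ℝ) ≤ cornerDist D b x) ∧
      ∃ x ∈ A, cornerDist D b x < (j + 1) / q := by
  have hq' : (0 : ℝ) < q := Nat.cast_pos.2 hq
  have hnonneg : ∀ u ∈ cornerDist D b '' A, 0 ≤ u :=
    Set.forall_mem_image.2 fun x hx => cornerDist_nonneg D b (hA hx)
  set a : ℝ := sInf (cornerDist D b '' A)
  have ha : 0 ≤ a := le_csInf (hA₀.image _) hnonneg
  have hle : ∀ x ∈ A, (⌊a * q⌋₊ / q : ℝ) ≤ cornerDist D b x := fun x hx =>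
    ((div_le_iff₀ hq').2 (Nat.floor_le (by positivity))).trans
      (csInf_le ⟨0, hnonneg⟩ (Set.mem_image_of_mem _ hx))
  obtain ⟨_, ⟨x, hx, rfl⟩, hxj⟩ : ∃ u ∈ cornerDist D b '' A, u < (⌊a * q⌋₊ + 1) / q :=
    exists_lt_of_csInf_lt (hA₀.image _) ((lt_div_iff₀ hq').2 (Nat.lt_floor_add_one _))
  refine ⟨⌊a * q⌋₊, ?_, hle, x, hx, hxj⟩
  exact_mod_cast (div_le_iff₀ hq').1 ((hle x hx).trans (cornerDist_le_card D b (hA hx)))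

theorem cantorMeasure_real_add_le_pairMass (D : Finset (Fin d)) (b b' : Fin d → Bool) {q : ℕ}
    (hq : 0 < q) (n : ℕ) {t : ℚ} {A B : Set (EuclideanSpace ℝ (Fin d))} (hA : A ⊆ unitCube d)
    (hB : B ⊆ unitCube d) (hA₀ : A.Nonempty) (hB₀ : B.Nonempty)
    (h : ∀ x ∈ A, ∀ y ∈ B, (t : ℝ) ≤ cornerDist D b x + cornerDist D b' y) :
    (cantorMeasure d).real A + (cantorMeasure d).real B ≤ pairMass #D q n t := by
  obtain ⟨j, hj, hle, x, hx, hxj⟩ := exists_nat_div_le_cornerDist D b hq hA hA₀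
  have hB_lt : ∀ y ∈ B, ((t - (j + 1) / q : ℚ) : ℝ) < cornerDist D b' y := fun y hy => by
    push_cast
    linarith [h x hx y hy]
  have hcond : t - (j + 1) / q < #D := by
    obtain ⟨y, hy⟩ := hB₀
    exact_mod_cast (hB_lt y hy).trans_le (cornerDist_le_card D b' (hB hy))
  have hA_le : (cantorMeasure d).real A ≤ tailMass #D n (j / q) :=
    (measureReal_mono fun x hx => by simpa using hle x hx).trans
      (cantorMeasure_real_le_cornerDist_le_tailMass D b n _)
  have hB_le : (cantorMeasure d).real B ≤ tailMass #D n (t - (j + 1) / q) :=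
    (measureReal_mono fun y hy => (hB_lt y hy).le).trans
      (cantorMeasure_real_le_cornerDist_le_tailMass D b' n _)
  have hmax : tailMass #D n (j / q) + tailMass #D n (t - (j + 1) / q) ≤ pairMass #D q n t :=
    (if_pos hcond).ge.trans (Finset.le_sup' (fun j : ℕ => if t - (j + 1) / q < #D then
      tailMass #D n (j / q) + tailMass #D n (t - (j + 1) / q) else 0)
      (Finset.mem_range.2 (Nat.lt_succ_of_le hj)))
  exact (add_le_add hA_le hB_le).trans (by exact_mod_cast hmax)

end PairMass

section CornerPart

variable {d : ℕ} {U : Set (EuclideanSpace ℝ (Fin d))}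

/-- The part of `U` in the subcube at the corner `b`, rescaled to the unit cube. -/
def cornerPart (U : Set (EuclideanSpace ℝ (Fin d))) (b : Fin d → Bool) :
    Set (EuclideanSpace ℝ (Fin d)) :=
  cornerMap b ⁻¹' U ∩ unitCube d

theorem cantorMeasure_real_eq_sum_cornerPart (hU : MeasurableSet U) :
    (cantorMeasure d).real U = (∑ b, (cantorMeasure d).real (cornerPart U b)) / 2 ^ d := by
  simp only [cantorMeasure_real_eq_sum hU, cornerPart, cantorMeasure_real_inter_unitCube]

variable {δ : ℝ} {b b' : Fin d → Bool} (hU : ∀ x ∈ U, ∀ y ∈ U, dist x y ≤ δ)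
include hU

theorem le_cornerDist_add_cornerDist_of_mem_cornerPart {k : ℕ} (hk : hammingDist b b' = k) {r : ℝ}
    (hr : √k ≤ r) {x y : EuclideanSpace ℝ (Fin d)} (hx : x ∈ cornerPart U b)
    (hy : y ∈ cornerPart U b') :
    3 * (k - r * δ) ≤ cornerDist {l | b l ≠ b' l} b x + cornerDist {l | b l ≠ b' l} b' y := by
  have hdist : √k * dist (cornerMap b x) (cornerMap b' y) ≤ r * δ :=
    mul_le_mul hr (hU _ hx.1 _ hy.1) dist_nonneg ((Real.sqrt_nonneg _).trans hr)
  have hsub := sub_mul_dist_le_cornerDist_add_cornerDist b b' x y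
  rw [hk] at hsub
  linarith

theorem one_div_three_le_of_nonempty_cornerPart (hne : b ≠ b') (hb : (cornerPart U b).Nonempty)
    (hb' : (cornerPart U b').Nonempty) : 1 / 3 ≤ δ := by
  obtain ⟨x, hx⟩ := hb
  obtain ⟨y, hy⟩ := hb'
  have hone : 1 ≤ √(hammingDist b b' : ℝ) :=
    Real.one_le_sqrt.2 (Nat.one_le_cast.2 (hammingDist_pos.2 hne))
  linarith [sqrt_hammingDist_le_mul_dist hne hx.2 hy.2, hU _ hx.1 _ hy.1]

variable (hb : (cornerPart U b).Nonempty) (hb' : (cornerPart U b').Nonempty)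
include hb'

theorem cantorMeasure_real_cornerPart_le {k : ℕ} (hk : hammingDist b b' = k) (n : ℕ) {r : ℝ}
    (hr : √k ≤ r) {x : ℚ} (hx : (x : ℝ) ≤ 3 * (k - r * δ) - k) :
    (cantorMeasure d).real (cornerPart U b) ≤ tailMass k n x := by
  obtain ⟨y, hy⟩ := hb'
  have hsub : cornerPart U b ⊆ {z | (x : ℝ) ≤ cornerDist {l | b l ≠ b' l} b z} := fun z hz => by
    have hyk : _ ≤ (hammingDist b b' : ℝ) := cornerDist_le_card {l | b l ≠ b' l} b' hy.2
    rw [hk] at hyk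
    change (x : ℝ) ≤ _
    linarith [le_cornerDist_add_cornerDist_of_mem_cornerPart hU hk hr hz hy]
  subst hk
  exact (measureReal_mono hsub).trans (cantorMeasure_real_le_cornerDist_le_tailMass _ b n x)

include hb

theorem cantorMeasure_real_cornerPart_add_le {k : ℕ} (hk : hammingDist b b' = k) {q : ℕ}
    (hq : 0 < q) (n : ℕ) {r : ℝ} (hr : √k ≤ r) {t : ℚ} (ht : (t : ℝ) ≤ 3 * (k - r * δ)) :
    (cantorMeasure d).real (cornerPart U b) + (cantorMeasure d).real (cornerPart U b') ≤
      pairMass k q n t := by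
  have h : ∀ x ∈ cornerPart U b, ∀ y ∈ cornerPart U b',
      (t : ℝ) ≤ cornerDist {l | b l ≠ b' l} b x + cornerDist {l | b l ≠ b' l} b' y :=
    fun x hx y hy => ht.trans (le_cornerDist_add_cornerDist_of_mem_cornerPart hU hk hr hx hy)
  subst hk
  exact cantorMeasure_real_add_le_pairMass _ b b' hq n Set.inter_subset_right
    Set.inter_subset_right hb hb' h

end CornerPart

section CubeBound

theorem two_mul_sum_le_card_mul {ι : Type*} {s : Finset ι} {m : ι → ℝ} {f : ℝ}
    (hs : 2 ≤ #s) (h : ∀ i ∈ s, ∀ j ∈ s, i ≠ j → m i + m j ≤ f) :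
    2 * ∑ i ∈ s, m i ≤ #s * f := by
  classical
  have hcard : (2 : ℝ) ≤ #s := by exact_mod_cast hs
  have hrow : ∀ i ∈ s, (#s - 2) * m i + ∑ j ∈ s, m j ≤ (#s - 1) * f := fun i hi => by
    have hsum := Finset.sum_le_card_nsmul (s.erase i) (fun j => m i + m j) f fun j hj =>
      h i hi j (Finset.mem_of_mem_erase hj) (Finset.ne_of_mem_erase hj).symm
    rw [Finset.sum_add_distrib, Finset.sum_const, Finset.sum_erase_eq_sub hi,
      Finset.card_erase_of_mem hi, nsmul_eq_mul, nsmul_eq_mul, Nat.cast_pred (by omega)] at hsum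
    linarith
  have htotal := Finset.sum_le_sum hrow
  rw [Finset.sum_add_distrib, ← Finset.mul_sum, Finset.sum_const, Finset.sum_const, nsmul_eq_mul,
    nsmul_eq_mul] at htotal
  exact le_of_mul_le_mul_left (by linarith) (by linarith : (0 : ℝ) < #s - 1)

/-- A bound for the total weight of the eight corners of a cube, at least two of which have nonzero
weight, if the weights of two corners with nonzero weight which differ in `k` coordinates add up to
at most `f₁`, `f₂`, `f₃` for `k = 1, 2, 3`, and are each at most `g` for `k = 1`. -/
def cubeBound {K : Type*} [Field K] [LinearOrder K] (f₁ f₂ f₃ g : K) : K :=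
  max f₁ (max (max g f₃ + 3 / 2 * f₂) (max (3 * f₂) (max g f₃ + 3 * f₃)))

theorem ratCast_cubeBound (f₁ f₂ f₃ g : ℚ) :
    ((cubeBound f₁ f₂ f₃ g : ℚ) : ℝ) = cubeBound (f₁ : ℝ) f₂ f₃ g := by
  simp [cubeBound]

theorem two_mul_sum_le_mul_of_card_le {ι : Type*} {s : Finset ι} {m : ι → ℝ} {f : ℝ} {c : ℕ}
    (hm : ∀ i, 0 ≤ m i) (hs : 2 ≤ #s) (hc : #s ≤ c)
    (h : ∀ i ∈ s, ∀ j ∈ s, i ≠ j → m i + m j ≤ f) : 2 * ∑ i ∈ s, m i ≤ c * f := by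
  obtain ⟨i, hi, j, hj, hij⟩ := Finset.one_lt_card.1 hs
  have hf : 0 ≤ f := (add_nonneg (hm i) (hm j)).trans (h i hi j hj hij)
  exact (two_mul_sum_le_card_mul hs h).trans (by gcongr)

section Antipodal

-- The corners of one parity carry the weights `e`, their antipodes the weights `o`; `s` and `t`
-- are the supports.
variable {e o : Fin 4 → ℝ} {s t : Finset (Fin 4)} {f₁ f₂ f₃ g : ℝ}
  (he : ∀ i, 0 ≤ e i) (ho : ∀ i, 0 ≤ o i)
  (h₂ : ∀ i ∈ s, ∀ j ∈ s, i ≠ j → e i + e j ≤ f₂)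
  (h₂' : ∀ i ∈ t, ∀ j ∈ t, i ≠ j → o i + o j ≤ f₂)
  (h₃ : ∀ i ∈ s, i ∈ t → e i + o i ≤ f₃)
  (h₁ : ∀ i ∈ s, ∀ j ∈ t, i ≠ j → e i + o j ≤ f₁ ∧ e i ≤ g ∧ o j ≤ g)

include he h₂ h₃ h₁ in
theorem sum_add_le_cubeBound {j : Fin 4} (hj : j ∈ t) (hs : 2 ≤ #s) :
    ∑ i ∈ s, e i + o j ≤ cubeBound f₁ f₂ f₃ g := by
  refine le_max_of_le_right (le_max_of_le_left ?_)
  obtain hcard | hcard := Nat.lt_or_ge 3 #s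
  · obtain rfl : s = Finset.univ :=
      (Finset.card_eq_iff_eq_univ s).1 (le_antisymm (card_finset_fin_le s) hcard)
    have hcard' : #(Finset.univ.erase j) = 3 := Finset.card_erase_of_mem (Finset.mem_univ j)
    have hrest := two_mul_sum_le_card_mul (s := Finset.univ.erase j) (m := e) (by omega)
      fun i _ i' _ => h₂ i (Finset.mem_univ i) i' (Finset.mem_univ i')
    rw [hcard'] at hrest
    push_cast at hrest
    rw [← Finset.add_sum_erase _ _ (Finset.mem_univ j)]
    linarith [h₃ j (Finset.mem_univ j) hj, le_max_right g f₃]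
  · obtain ⟨i, hi, hij⟩ := Finset.exists_mem_ne hs j
    have hsum := two_mul_sum_le_mul_of_card_le he hs hcard h₂
    push_cast at hsum
    linarith [(h₁ i hi j hj hij).2.2, le_max_left g f₃]

include he ho h₃ h₁ in
theorem add_le_cubeBound {i j : Fin 4} (hi : i ∈ s) (hj : j ∈ t) :
    e i + o j ≤ cubeBound f₁ f₂ f₃ g := by
  obtain rfl | hij := eq_or_ne i j
  · have hf₃ := h₃ i hi hj
    refine le_max_of_le_right (le_max_of_le_right (le_max_of_le_right ?_))
    linarith [he i, ho i, le_max_right g f₃]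
  · exact le_max_of_le_left (h₁ i hi j hj hij).1

include h₃ h₁ in
theorem sum_univ_add_sum_le_cubeBound (hs : s = Finset.univ) (ht : 3 ≤ #t) :
    ∑ i ∈ s, e i + ∑ i ∈ t, o i ≤ cubeBound f₁ f₂ f₃ g := by
  subst hs
  obtain ⟨j, hj⟩ : ∃ j, ∀ i ≠ j, i ∈ t :=
    (by decide : ∀ t : Finset (Fin 4), 3 ≤ #t → ∃ j, ∀ i ≠ j, i ∈ t) t ht
  have hmax : e j + (if j ∈ t then o j else 0) ≤ max g f₃ := by
    split_ifs with hjt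
    · exact le_max_of_le_right (h₃ j (Finset.mem_univ j) hjt)
    · obtain ⟨i, hi⟩ := exists_ne j
      rw [add_zero]
      exact le_max_of_le_left (h₁ j (Finset.mem_univ j) i (hj i hi) hi.symm).2.1
  have hrest := Finset.sum_le_card_nsmul (Finset.univ.erase j)
    (fun i => e i + if i ∈ t then o i else 0) f₃ fun i hi => by
      have hit := hj i (Finset.ne_of_mem_erase hi)
      simpa only [if_pos hit] using h₃ i (Finset.mem_univ i) hit
  rw [Finset.card_erase_of_mem (Finset.mem_univ j), nsmul_eq_mul] at hrest
  rw [← Fintype.sum_ite_mem t o, ← Finset.sum_add_distrib,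
    ← Finset.add_sum_erase _ _ (Finset.mem_univ j)]
  exact le_max_of_le_right (le_max_of_le_right (le_max_of_le_right (add_le_add hmax hrest)))

include he ho h₂ h₂' h₃ h₁

theorem sum_add_sum_le_cubeBound_of_card_le (hts : #t ≤ #s) (hcard : 2 ≤ #s + #t) :
    ∑ i ∈ s, e i + ∑ i ∈ t, o i ≤ cubeBound f₁ f₂ f₃ g := by
  have hs4 := card_finset_fin_le s
  obtain ht | ht | ht : #t = 0 ∨ #t = 1 ∨ 2 ≤ #t := by omega
  · have hsum := two_mul_sum_le_mul_of_card_le (c := 6) he (by omega) (by omega) h₂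
    rw [Finset.card_eq_zero.1 ht, Finset.sum_empty]
    push_cast at hsum
    exact le_max_of_le_right (le_max_of_le_right (le_max_of_le_left (by linarith)))
  · obtain ⟨j, rfl⟩ := Finset.card_eq_one.1 ht
    have hj := Finset.mem_singleton_self j
    rw [Finset.sum_singleton]
    obtain hs | hs : #s = 1 ∨ 2 ≤ #s := by omega
    · obtain ⟨i, rfl⟩ := Finset.card_eq_one.1 hs
      rw [Finset.sum_singleton]
      exact add_le_cubeBound he ho h₃ h₁ (Finset.mem_singleton_self i) hj
    · exact sum_add_le_cubeBound he h₂ h₃ h₁ hj hs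
  · obtain hsmall | hlarge := Nat.lt_or_ge 6 (#s + #t)
    · exact sum_univ_add_sum_le_cubeBound h₃ h₁
        ((Finset.card_eq_iff_eq_univ s).1 (by simp; omega)) (by omega)
    · have hsum := two_mul_sum_le_card_mul (by omega) h₂
      have hsum' := two_mul_sum_le_mul_of_card_le (c := 6 - #s) ho ht (by omega) h₂'
      rw [Nat.cast_sub (by omega)] at hsum'
      push_cast at hsum'
      exact le_max_of_le_right (le_max_of_le_right (le_max_of_le_left (by linarith)))

theorem sum_add_sum_le_cubeBound (hcard : 2 ≤ #s + #t) :
    ∑ i ∈ s, e i + ∑ i ∈ t, o i ≤ cubeBound f₁ f₂ f₃ g := by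
  obtain hts | hst := le_total #t #s
  · exact sum_add_sum_le_cubeBound_of_card_le he ho h₂ h₂' h₃ h₁ hts hcard
  · rw [add_comm]
    refine sum_add_sum_le_cubeBound_of_card_le ho he h₂' h₂
      (fun i hi hi' => (add_comm _ _).trans_le (h₃ i hi' hi))
      (fun i hi j hj hij => ?_) hst (by omega)
    obtain ⟨hsum, hle, hle'⟩ := h₁ j hj i hi hij.symm
    exact ⟨(add_comm _ _).trans_le hsum, hle', hle⟩

end Antipodal

/-- The four corners of the cube with an even number of coordinates equal to `1`; the others are
their antipodes. -/
def evenCorner : Fin 4 → Fin 3 → Bool :=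
  ![![false, false, false], ![false, true, true], ![true, false, true], ![true, true, false]]

theorem bijective_evenCorner_not_evenCorner :
    Function.Bijective (Sum.elim evenCorner fun i l => !evenCorner i l) := by
  decide

theorem hammingDist_evenCorner {i j : Fin 4} (hij : i ≠ j) :
    hammingDist (evenCorner i) (evenCorner j) = 2 := by
  decide +revert

theorem hammingDist_not_evenCorner {i j : Fin 4} (hij : i ≠ j) :
    hammingDist (fun l => !evenCorner i l) (fun l => !evenCorner j l) = 2 := by
  decide +revert

theorem hammingDist_evenCorner_not_self (i : Fin 4) :
    hammingDist (evenCorner i) (fun l => !evenCorner i l) = 3 := by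
  decide +revert

theorem hammingDist_evenCorner_not {i j : Fin 4} (hij : i ≠ j) :
    hammingDist (evenCorner i) (fun l => !evenCorner j l) = 1 := by
  decide +revert

theorem sum_corner_le_cubeBound {m : (Fin 3 → Bool) → ℝ} {f₁ f₂ f₃ g : ℝ} (hm : ∀ b, 0 ≤ m b)
    (hne : ∃ b b', b ≠ b' ∧ m b ≠ 0 ∧ m b' ≠ 0)
    (h₁ : ∀ b b', hammingDist b b' = 1 → m b ≠ 0 → m b' ≠ 0 → m b + m b' ≤ f₁ ∧ m b ≤ g)
    (h₂ : ∀ b b', hammingDist b b' = 2 → m b ≠ 0 → m b' ≠ 0 → m b + m b' ≤ f₂)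
    (h₃ : ∀ b b', hammingDist b b' = 3 → m b ≠ 0 → m b' ≠ 0 → m b + m b' ≤ f₃) :
    ∑ b, m b ≤ cubeBound f₁ f₂ f₃ g := by
  set e : Fin 4 → ℝ := fun i => m (evenCorner i)
  set o : Fin 4 → ℝ := fun i => m fun l => !evenCorner i l
  have hsum : ∑ b, m b = ∑ i, e i + ∑ i, o i := by
    rw [← bijective_evenCorner_not_evenCorner.sum_comp, Fintype.sum_sum_type]
    rfl
  have hcard : 2 ≤ #{i | e i ≠ 0} + #{i | o i ≠ 0} := by
    obtain ⟨b, b', hbb', hb, hb'⟩ := hne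
    obtain ⟨u, rfl⟩ := bijective_evenCorner_not_evenCorner.surjective b
    obtain ⟨u', rfl⟩ := bijective_evenCorner_not_evenCorner.surjective b'
    rw [← Finset.card_disjSum]
    refine Finset.one_lt_card.2 ⟨u, ?_, u', ?_, fun h => hbb' (congrArg _ h)⟩
    · cases u <;> simpa using hb
    · cases u' <;> simpa using hb'
  rw [hsum, ← Finset.sum_filter_ne_zero, ← Finset.sum_filter_ne_zero (f := o)]
  refine sum_add_sum_le_cubeBound (fun i => hm _) (fun i => hm _) ?_ ?_ ?_ ?_ hcard <;>
    simp only [Finset.mem_filter_univ]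
  · exact fun i hi j hj hij => h₂ _ _ (hammingDist_evenCorner hij) hi hj
  · exact fun i hi j hj hij => h₂ _ _ (hammingDist_not_evenCorner hij) hi hj
  · exact fun i hi hi' => h₃ _ _ (hammingDist_evenCorner_not_self i) hi hi'
  · intro i hi j hj hij
    have hdist := hammingDist_evenCorner_not hij
    obtain ⟨hpair, hle⟩ := h₁ _ _ hdist hi hj
    exact ⟨hpair, hle, (h₁ _ _ ((hammingDist_comm _ _).trans hdist) hj hi).2⟩

end CubeBound

section Exponent

theorem logb_le_div_of_pow_le {b x : ℝ} (hb : 1 < b) (hx : 0 < x) {m n : ℕ} (hn : n ≠ 0)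
    (h : x ^ n ≤ b ^ m) : Real.logb b x ≤ m / n := by
  have hlog := Real.logb_le_logb_of_le hb (pow_pos hx n) h
  rw [Real.logb_pow, Real.logb_pow, Real.logb_self_eq_one hb, mul_one] at hlog
  exact (le_div_iff₀' (by positivity)).2 hlog

theorem div_le_logb_of_pow_le {b x : ℝ} (hb : 1 < b) {m n : ℕ} (hn : n ≠ 0)
    (h : b ^ m ≤ x ^ n) : (m / n : ℝ) ≤ Real.logb b x := by
  have hlog := Real.logb_le_logb_of_le hb (pow_pos (one_pos.trans hb) m) h
  rw [Real.logb_pow, Real.logb_pow, Real.logb_self_eq_one hb, mul_one] at hlog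
  exact (div_le_iff₀' (by positivity)).2 hlog

theorem logb_three_two_le : Real.logb 3 2 ≤ 53 / 84 := by
  exact_mod_cast logb_le_div_of_pow_le (b := 3) (x := 2) (m := 53) (n := 84) (by norm_num)
    (by norm_num) (by norm_num) (by norm_num)

theorem le_logb_three_two : 17 / 27 ≤ Real.logb 3 2 := by
  exact_mod_cast div_le_logb_of_pow_le (b := 3) (x := 2) (m := 17) (n := 27) (by norm_num)
    (by norm_num) (by norm_num)

theorem cantorExponent_nonneg (d : ℕ) : 0 ≤ cantorExponent d :=
  mul_nonneg d.cast_nonneg (Real.logb_nonneg (by norm_num) (by norm_num))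

theorem three_rpow_cantorExponent (d : ℕ) : (3 : ℝ) ^ cantorExponent d = 2 ^ d := by
  rw [cantorExponent, mul_comm, Real.rpow_mul (by norm_num),
    Real.rpow_logb (by norm_num) (by norm_num) (by norm_num), Real.rpow_natCast]

theorem cantorExponent_three_le : cantorExponent 3 ≤ (53 : ℕ) / (28 : ℕ) := by
  rw [cantorExponent]
  push_cast
  linarith [logb_three_two_le]

theorem le_cantorExponent_three : ((17 : ℕ) / (9 : ℕ) : ℝ) ≤ cantorExponent 3 := by
  rw [cantorExponent]
  push_cast
  linarith [le_logb_three_two]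

variable {x v s : ℝ} {m n : ℕ}

theorem rpow_div_pow (hx : 0 ≤ x) (hn : n ≠ 0) : (x ^ (m / n : ℝ)) ^ n = x ^ m := by
  rw [← Real.rpow_mul_natCast hx, div_mul_cancel₀ _ (Nat.cast_ne_zero.2 hn), Real.rpow_natCast]

theorem le_rpow_div_of_pow_le (hx : 0 ≤ x) (hn : n ≠ 0) (h : v ^ n ≤ x ^ m) :
    v ≤ x ^ (m / n : ℝ) :=
  le_of_pow_le_pow_left₀ hn (Real.rpow_nonneg hx _) (h.trans_eq (rpow_div_pow hx hn).symm)

theorem rpow_div_le_of_pow_le (hx : 0 ≤ x) (hv : 0 ≤ v) (hn : n ≠ 0) (h : x ^ m ≤ v ^ n) :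
    x ^ (m / n : ℝ) ≤ v :=
  le_of_pow_le_pow_left₀ hn hv ((rpow_div_pow hx hn).trans_le h)

theorem le_rpow_of_pow_le_pow {lo : ℚ} {m' n' : ℕ} (hlo : 0 < lo) (hlox : lo ≤ x) (hn : n ≠ 0)
    (hn' : n' ≠ 0) (hs : (m / n : ℝ) ≤ s) (hs' : s ≤ m' / n') (h : v ^ n ≤ lo ^ m)
    (h' : v ^ n' ≤ lo ^ m') : v ≤ x ^ s := by
  have hlo' : (0 : ℝ) < lo := Rat.cast_pos.2 hlo
  have hs₀ : 0 ≤ s := le_trans (by positivity) hs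
  refine le_trans ?_ (Real.rpow_le_rpow hlo'.le hlox hs₀)
  obtain hle | hge := le_total (lo : ℝ) 1
  · exact (le_rpow_div_of_pow_le hlo'.le hn' h').trans
      (Real.rpow_le_rpow_of_exponent_ge hlo' hle hs')
  · exact (le_rpow_div_of_pow_le hlo'.le hn h).trans
      (Real.rpow_le_rpow_of_exponent_le hge hs)

end Exponent

section Renormalization

variable {d : ℕ}

theorem sum_eq_single_or_exists_ne {ι M : Type*} [Fintype ι] [Nonempty ι] [AddCommMonoid M]
    (f : ι → M) : (∃ i, ∑ j, f j = f i) ∨ ∃ i j, i ≠ j ∧ f i ≠ 0 ∧ f j ≠ 0 := by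
  by_cases h : ∃ i, f i ≠ 0
  · obtain ⟨i, hi⟩ := h
    by_cases h' : ∃ j, i ≠ j ∧ f j ≠ 0
    · obtain ⟨j, hij, hj⟩ := h'
      exact .inr ⟨i, j, hij, hi, hj⟩
    · push Not at h'
      exact .inl ⟨i, Fintype.sum_eq_single i fun j hj => h' j hj.symm⟩
  · push Not at h
    exact .inl ⟨Classical.arbitrary ι, by simp [h]⟩

theorem mul_cantorMeasure_le_rpow_of_cornerMap {c δ : ℝ} (hδ : 0 ≤ δ)
    {U : Set (EuclideanSpace ℝ (Fin d))} (hU : MeasurableSet U) {b : Fin d → Bool}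
    (hsum : ∑ b, (cantorMeasure d).real (cornerPart U b) =
      (cantorMeasure d).real (cornerPart U b))
    (hb : c * (cantorMeasure d).real (cornerMap b ⁻¹' U) ≤ (3 * δ) ^ cantorExponent d) :
    c * (cantorMeasure d).real U ≤ δ ^ cantorExponent d := by
  rw [Real.mul_rpow (by norm_num) hδ, three_rpow_cantorExponent] at hb
  rw [cantorMeasure_real_eq_sum_cornerPart hU, hsum, cornerPart, cantorMeasure_real_inter_unitCube,
    mul_div_assoc', div_le_iff₀' (by positivity)]
  exact hb

variable {c r : ℝ} (hc : 0 ≤ c) (hlarge : ∀ δ ≥ r, c ≤ δ ^ cantorExponent d)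
  (hparts : ∀ {U : Set (EuclideanSpace ℝ (Fin d))} {δ : ℝ} {b b' : Fin d → Bool},
    δ ≤ r → (∀ x ∈ U, ∀ y ∈ U, dist x y ≤ δ) → b ≠ b' →
    (cantorMeasure d).real (cornerPart U b) ≠ 0 → (cantorMeasure d).real (cornerPart U b') ≠ 0 →
    c * ∑ b, (cantorMeasure d).real (cornerPart U b) ≤ 2 ^ d * δ ^ cantorExponent d)
include hc hlarge hparts

theorem mul_cantorMeasure_le_rpow_of_le_pow_mul (n : ℕ) {U : Set (EuclideanSpace ℝ (Fin d))}
    {δ : ℝ} (hUm : MeasurableSet U) (hδ : 0 ≤ δ) (hU : ∀ x ∈ U, ∀ y ∈ U, dist x y ≤ δ)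
    (hn : r ≤ 3 ^ n * δ) : c * (cantorMeasure d).real U ≤ δ ^ cantorExponent d := by
  obtain hr | hr := le_total r δ
  · exact (mul_le_of_le_one_right hc measureReal_le_one).trans (hlarge δ hr)
  induction n generalizing U δ with
  | zero =>
    rw [pow_zero, one_mul] at hn
    exact (mul_le_of_le_one_right hc measureReal_le_one).trans (hlarge δ hn)
  | succ n ih =>
    obtain ⟨b, hb⟩ | ⟨b, b', hne, hb, hb'⟩ :=
      sum_eq_single_or_exists_ne fun b => (cantorMeasure d).real (cornerPart U b)
    · refine mul_cantorMeasure_le_rpow_of_cornerMap hδ hUm hb ?_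
      obtain hr' | hr' := le_total r (3 * δ)
      · exact (mul_le_of_le_one_right hc measureReal_le_one).trans (hlarge _ hr')
      refine ih ((continuous_cornerMap b).measurable hUm) (by positivity) (fun x hx y hy => ?_)
        (by rwa [← mul_assoc, ← pow_succ]) hr'
      have hdist := hU _ hx _ hy
      rw [dist_cornerMap] at hdist
      linarith
    · rw [cantorMeasure_real_eq_sum_cornerPart hUm, mul_div_assoc', div_le_iff₀' (by positivity)]
      exact hparts hr hU hne hb hb'

theorem mul_cantorMeasure_le_diam_rpow {U : Set (EuclideanSpace ℝ (Fin d))}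
    (hU : Bornology.IsBounded U) :
    c * (cantorMeasure d).real U ≤ Metric.diam U ^ cantorExponent d := by
  have hle : ∀ δ > Metric.diam U, c * (cantorMeasure d).real U ≤ δ ^ cantorExponent d := by
    intro δ hδ
    have hδ₀ : 0 < δ := Metric.diam_nonneg.trans_lt hδ
    obtain ⟨n, hn⟩ := pow_unbounded_of_one_lt (r / δ) (by norm_num : (1 : ℝ) < 3)
    have hclosure : (cantorMeasure d).real U ≤ (cantorMeasure d).real (closure U) :=
      measureReal_mono subset_closure
    refine (mul_le_mul_of_nonneg_left hclosure hc).trans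
      (mul_cantorMeasure_le_rpow_of_le_pow_mul hc hlarge hparts n isClosed_closure.measurableSet
        hδ₀.le (fun x hx y hy => ?_) ((div_lt_iff₀ hδ₀).1 hn).le)
    rw [← Metric.diam_closure] at hδ
    exact (Metric.dist_le_diam_of_mem hU.closure hx hy).trans hδ.le
  have hcont := (Real.continuousAt_rpow_const (Metric.diam U) (cantorExponent d)
    (.inr (cantorExponent_nonneg d))).tendsto.mono_left
      (nhdsWithin_le_nhds (s := Set.Ioi (Metric.diam U)))
  exact ge_of_tendsto hcont (eventually_of_mem self_mem_nhdsWithin hle)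

theorem ofReal_le_hausdorffMeasure_cantorProduct :
    ENNReal.ofReal c ≤ μH[cantorExponent d] (cantorProduct d) := by
  have h : ENNReal.ofReal c • cantorMeasure d ≤ μH[cantorExponent d] := by
    refine Measure.le_hausdorffMeasure _ _ 1 one_pos fun U hU => ?_
    have hfin : Metric.ediam U ≠ ∞ := (hU.trans_lt ENNReal.one_lt_top).ne
    have hle := ENNReal.ofReal_le_ofReal
      (mul_cantorMeasure_le_diam_rpow hc hlarge hparts (Metric.isBounded_iff_ediam_ne_top.2 hfin))
    rw [ENNReal.ofReal_mul hc, ofReal_measureReal,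
      ← ENNReal.ofReal_rpow_of_nonneg Metric.diam_nonneg (cantorExponent_nonneg d),
      Metric.diam, ENNReal.ofReal_toReal hfin] at hle
    exact hle
  simpa [cantorMeasure_cantorProduct] using h (cantorProduct d)

end Renormalization

section ScaleTable

/-- A computable upper bound for the total mass of the rescaled parts of a set of diameter at most
`δ` in the eight subcubes of the cube, if at least two parts have positive mass; `1.415` and `1.733`
stand for `√2` and `√3`. -/
def scaleBound (δ : ℚ) : ℚ :=
  cubeBound (pairMass 1 15 4 (3 * (1 - δ))) (pairMass 2 15 4 (3 * (2 - 1.415 * δ)))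
    (pairMass 3 15 4 (3 * (3 - 1.733 * δ))) (tailMass 1 4 (3 * (1 - δ) - 1))

theorem sum_cornerPart_le_scaleBound {U : Set (EuclideanSpace ℝ (Fin 3))} {δ : ℝ}
    (hU : ∀ x ∈ U, ∀ y ∈ U, dist x y ≤ δ) {hi : ℚ} (hδ : δ ≤ hi)
    (hne : ∃ b b', b ≠ b' ∧ (cantorMeasure 3).real (cornerPart U b) ≠ 0 ∧
      (cantorMeasure 3).real (cornerPart U b') ≠ 0) :
    ∑ b, (cantorMeasure 3).real (cornerPart U b) ≤ scaleBound hi := by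
  have hU' : ∀ x ∈ U, ∀ y ∈ U, dist x y ≤ hi := fun x hx y hy => (hU x hx y hy).trans hδ
  have hnonempty : ∀ b, (cantorMeasure 3).real (cornerPart U b) ≠ 0 → (cornerPart U b).Nonempty :=
    fun b hb => nonempty_of_measureReal_ne_zero hb
  have hsqrt₁ : √(1 : ℕ) ≤ 1 := by simp
  have hsqrt₂ : √(2 : ℕ) ≤ 1.415 := (Real.sqrt_le_left (by norm_num)).2 (by norm_num)
  have hsqrt₃ : √(3 : ℕ) ≤ 1.733 := (Real.sqrt_le_left (by norm_num)).2 (by norm_num)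
  rw [scaleBound, ratCast_cubeBound]
  refine sum_corner_le_cubeBound (fun b => measureReal_nonneg) hne ?_ ?_ ?_
  · refine fun b b' hk hb hb' => ⟨?_, ?_⟩
    · exact cantorMeasure_real_cornerPart_add_le hU' (hnonempty b hb) (hnonempty b' hb') hk
        (by norm_num) 4 hsqrt₁ (by push_cast; linarith)
    · exact cantorMeasure_real_cornerPart_le hU' (hnonempty b' hb') hk 4 hsqrt₁
        (by push_cast; linarith)
  · exact fun b b' hk hb hb' => cantorMeasure_real_cornerPart_add_le hU' (hnonempty b hb)
      (hnonempty b' hb') hk (by norm_num) 4 hsqrt₂ (by push_cast; linarith)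
  · exact fun b b' hk hb hb' => cantorMeasure_real_cornerPart_add_le hU' (hnonempty b hb)
      (hnonempty b' hb') hk (by norm_num) 4 hsqrt₃ (by push_cast; linarith)

/-- A checkable condition under which the desired inequality
`1.812 * scaleBound δ / 8 ≤ δ ^ cantorExponent 3` holds for `lo ≤ δ ≤ hi`. The fractions `17 / 9`
and `53 / 28` enclose `cantorExponent 3`. -/
def IsScaleStep (lo hi : ℚ) : Prop :=
  0 < lo ∧ (1.812 * scaleBound hi / 8) ^ 9 ≤ lo ^ 17 ∧ (1.812 * scaleBound hi / 8) ^ 28 ≤ lo ^ 53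

instance (lo hi : ℚ) : Decidable (IsScaleStep lo hi) := inferInstanceAs (Decidable (_ ∧ _))

theorem IsScaleStep.mul_sum_cornerPart_le {lo hi : ℚ} (h : IsScaleStep lo hi)
    {U : Set (EuclideanSpace ℝ (Fin 3))} {δ : ℝ} (hU : ∀ x ∈ U, ∀ y ∈ U, dist x y ≤ δ)
    (hlo : lo ≤ δ) (hhi : δ ≤ hi)
    (hne : ∃ b b', b ≠ b' ∧ (cantorMeasure 3).real (cornerPart U b) ≠ 0 ∧
      (cantorMeasure 3).real (cornerPart U b') ≠ 0) :
    1.812 * ∑ b, (cantorMeasure 3).real (cornerPart U b) ≤ 2 ^ 3 * δ ^ cantorExponent 3 := by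
  have hle : ((1.812 * scaleBound hi / 8 : ℚ) : ℝ) ≤ δ ^ cantorExponent 3 :=
    le_rpow_of_pow_le_pow h.1 hlo (by norm_num) (by norm_num) le_cantorExponent_three
      cantorExponent_three_le (by exact_mod_cast h.2.1) (by exact_mod_cast h.2.2)
  push_cast at hle
  linarith [sum_cornerPart_le_scaleBound hU hhi hne]

theorem isChain_isScaleStep :
    [1 / 3, 0.41, 0.5, 0.61, 0.68, 0.74, 0.81, 0.9, 0.95, 1, 1.06, 1.15, 1.27, 1.39].IsChain
      IsScaleStep := by
  decide +kernel

theorem exists_le_and_le_of_isChain {α β : Type*} [LinearOrder β] (f : α → β) {R : α → α → Prop}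
    {a b : α} {l : List α} (h : (a :: b :: l).IsChain R) {x : β} (ha : f a ≤ x)
    (hx : x ≤ f ((b :: l).getLast (l.cons_ne_nil b))) :
    ∃ lo hi, R lo hi ∧ f lo ≤ x ∧ x ≤ f hi := by
  obtain ⟨hab, hl⟩ := List.isChain_cons_cons.1 h
  obtain hxb | hbx := le_total x (f b)
  · exact ⟨a, b, hab, ha, hxb⟩
  cases l with
  | nil => exact ⟨a, b, hab, ha, hx⟩
  | cons c l => exact exists_le_and_le_of_isChain f hl hbx hx

theorem mul_sum_cornerPart_le {U : Set (EuclideanSpace ℝ (Fin 3))} {δ : ℝ}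
    {b b' : Fin 3 → Bool} (hδ : δ ≤ 1.39) (hU : ∀ x ∈ U, ∀ y ∈ U, dist x y ≤ δ) (hbb' : b ≠ b')
    (hb : (cantorMeasure 3).real (cornerPart U b) ≠ 0)
    (hb' : (cantorMeasure 3).real (cornerPart U b') ≠ 0) :
    1.812 * ∑ b, (cantorMeasure 3).real (cornerPart U b) ≤ 2 ^ 3 * δ ^ cantorExponent 3 := by
  have hδ' : 1 / 3 ≤ δ := one_div_three_le_of_nonempty_cornerPart hU hbb'
    (nonempty_of_measureReal_ne_zero hb) (nonempty_of_measureReal_ne_zero hb')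
  obtain ⟨lo, hi, hstep, hlo, hhi⟩ := exists_le_and_le_of_isChain (fun u : ℚ => (u : ℝ))
    isChain_isScaleStep (x := δ) (by push_cast; exact hδ') (hδ.trans_eq (by norm_num))
  exact hstep.mul_sum_cornerPart_le hU hlo hhi ⟨b, b', hbb', hb, hb'⟩

theorem le_rpow_cantorExponent_three {δ : ℝ} (hδ : 1.39 ≤ δ) : 1.812 ≤ δ ^ cantorExponent 3 :=
  le_rpow_of_pow_le_pow (lo := 1.39) (by norm_num) (le_trans (by norm_num) hδ) (by norm_num)
    (by norm_num) le_cantorExponent_three cantorExponent_three_le (by norm_num) (by norm_num)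

theorem le_hausdorffMeasure_cantorProduct_three :
    ENNReal.ofReal 1.812 ≤ μH[cantorExponent 3] (cantorProduct 3) :=
  ofReal_le_hausdorffMeasure_cantorProduct (by norm_num)
    (fun _ hδ => le_rpow_cantorExponent_three hδ) mul_sum_cornerPart_le

end ScaleTable

section Covering

variable {d : ℕ}

/-- The pieces of the `n`-th generation of the Cantor product. -/
noncomputable def cantorPiece : (n : ℕ) → (Fin n → Fin d → Bool) → Set (EuclideanSpace ℝ (Fin d))
  | 0, _ => cantorProduct d
  | n + 1, w => cornerMap (w 0) '' cantorPiece n (Fin.tail w)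

theorem exists_cornerMap_eq_of_mem_cantorProduct {x : EuclideanSpace ℝ (Fin d)}
    (hx : x ∈ cantorProduct d) : ∃ b, ∃ y ∈ cantorProduct d, cornerMap b y = x := by
  have hcoord : ∀ l, ∃ b : Bool, ∃ y ∈ cantorSet, ((if b then 2 else 0) + y) / 3 = x l := by
    intro l
    obtain ⟨y, hy, h⟩ | ⟨y, hy, h⟩ := cantorSet_eq_union_halves ▸ hx l
    · exact ⟨false, y, hy, by simp [← h]⟩
    · exact ⟨true, y, hy, by simp [← h]⟩
  choose b y hy hxy using hcoord
  exact ⟨b, WithLp.toLp 2 y, hy, PiLp.ext hxy⟩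

theorem cantorProduct_subset_iUnion_cantorPiece (n : ℕ) :
    cantorProduct d ⊆ ⋃ w, cantorPiece n w := by
  induction n with
  | zero => exact Set.subset_iUnion_of_subset Fin.elim0 subset_rfl
  | succ n ih =>
    intro x hx
    obtain ⟨b, y, hy, rfl⟩ := exists_cornerMap_eq_of_mem_cantorProduct hx
    obtain ⟨w, hw⟩ := Set.mem_iUnion.1 (ih hy)
    exact Set.mem_iUnion.2 ⟨Fin.cons b w, y, by rwa [Fin.tail_cons], by rw [Fin.cons_zero]⟩

theorem dist_le_sqrt_of_mem_unitCube {x y : EuclideanSpace ℝ (Fin d)} (hx : x ∈ unitCube d)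
    (hy : y ∈ unitCube d) : dist x y ≤ √d := by
  rw [EuclideanSpace.dist_eq]
  refine Real.sqrt_le_sqrt ((Finset.sum_le_card_nsmul _ _ 1 fun l _ => ?_).trans_eq (by simp))
  exact pow_le_one₀ dist_nonneg ((Real.dist_le_of_mem_Icc (hx l) (hy l)).trans_eq (by norm_num))

theorem dist_le_of_mem_cantorPiece {n : ℕ} {w : Fin n → Fin d → Bool}
    {x y : EuclideanSpace ℝ (Fin d)} (hx : x ∈ cantorPiece n w) (hy : y ∈ cantorPiece n w) :
    dist x y ≤ √d / 3 ^ n := by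
  induction n generalizing x y with
  | zero =>
    rw [pow_zero, div_one]
    exact dist_le_sqrt_of_mem_unitCube (cantorProduct_subset_unitCube hx)
      (cantorProduct_subset_unitCube hy)
  | succ n ih =>
    obtain ⟨x, hx, rfl⟩ := hx
    obtain ⟨y, hy, rfl⟩ := hy
    rw [dist_cornerMap, pow_succ, ← div_div]
    exact div_le_div_of_nonneg_right (ih hx hy) (by norm_num)

theorem ediam_cantorPiece_le (n : ℕ) (w : Fin n → Fin d → Bool) :
    Metric.ediam (cantorPiece n w) ≤ ENNReal.ofReal (√d / 3 ^ n) :=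
  Metric.ediam_le fun x hx y hy => by
    rw [edist_dist]
    exact ENNReal.ofReal_le_ofReal (dist_le_of_mem_cantorPiece hx hy)

theorem sum_ediam_cantorPiece_rpow_le (d n : ℕ) :
    ∑ w : Fin n → Fin d → Bool, Metric.ediam (cantorPiece n w) ^ cantorExponent d ≤
      ENNReal.ofReal (√d ^ cantorExponent d) := by
  have hs := cantorExponent_nonneg d
  have hpow : ((3 : ℝ) ^ n) ^ cantorExponent d = (2 ^ d) ^ n := by
    rw [← Real.rpow_natCast_mul (by norm_num), mul_comm, Real.rpow_mul_natCast (by norm_num),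
      three_rpow_cantorExponent]
  calc ∑ w : Fin n → Fin d → Bool, Metric.ediam (cantorPiece n w) ^ cantorExponent d
      ≤ ∑ _w : Fin n → Fin d → Bool, ENNReal.ofReal ((√d / 3 ^ n) ^ cantorExponent d) := by
        refine Finset.sum_le_sum fun w _ => ?_
        rw [← ENNReal.ofReal_rpow_of_nonneg (by positivity) hs]
        exact ENNReal.rpow_le_rpow (ediam_cantorPiece_le n w) hs
    _ = ENNReal.ofReal ((2 ^ d) ^ n * (√d / 3 ^ n) ^ cantorExponent d) := by
        rw [ENNReal.ofReal_mul (by positivity)]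
        simp
    _ = ENNReal.ofReal (√d ^ cantorExponent d) := by
        rw [Real.div_rpow (by positivity) (by positivity), hpow, mul_div_cancel₀ _ (by positivity)]

theorem hausdorffMeasure_cantorProduct_le (d : ℕ) :
    μH[cantorExponent d] (cantorProduct d) ≤ ENNReal.ofReal (√d ^ cantorExponent d) := by
  have hlim : Tendsto (fun n : ℕ => ENNReal.ofReal (√d / 3 ^ n)) atTop (𝓝 0) := by
    rw [← ENNReal.ofReal_zero]
    exact ENNReal.tendsto_ofReal
      (tendsto_const_nhds.div_atTop (tendsto_pow_atTop_atTop_of_one_lt (by norm_num)))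
  refine (Measure.hausdorffMeasure_le_liminf_sum _ _ _ hlim cantorPiece
    (.of_forall ediam_cantorPiece_le)
    (.of_forall cantorProduct_subset_iUnion_cantorPiece)).trans ?_
  exact (liminf_le_liminf (.of_forall (sum_ediam_cantorPiece_rpow_le d))).trans (by simp)

theorem sqrt_two_rpow_cantorExponent_le : √(2 : ℕ) ^ cantorExponent 2 ≤ 1.6 := by
  have hexp : cantorExponent 2 ≤ (4 : ℕ) / (3 : ℕ) := by
    rw [cantorExponent]
    push_cast
    linarith [logb_three_two_le]
  refine (Real.rpow_le_rpow_of_exponent_le (Real.one_le_sqrt.2 (by norm_num)) hexp).trans ?_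
  refine rpow_div_le_of_pow_le (Real.sqrt_nonneg _) (by norm_num) (by norm_num) ?_
  rw [pow_mul (√_) 2 2, Real.sq_sqrt (Nat.cast_nonneg _)]
  norm_num

end Covering

section ClosedForm

theorem sq_two_mul_sqrt_div_nine : (2 * √26 / 9) ^ 2 = (104 / 81 : ℝ) := by
  rw [div_pow, mul_pow, Real.sq_sqrt (by norm_num)]
  norm_num

theorem one_le_two_mul_sqrt_div_nine : 1 ≤ 2 * √26 / 9 := by
  refine le_of_pow_le_pow_left₀ two_ne_zero (by positivity) ?_
  rw [sq_two_mul_sqrt_div_nine]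
  norm_num

-- `971 / 1539` is the mediant of the convergents `306 / 485` and `665 / 1054` of `log₃ 2`.
theorem le_two_mul_sqrt_div_nine_rpow : (1.266862 : ℝ) ≤ (2 * √26 / 9) ^ (3 * Real.logb 3 2) := by
  have hlog : ((971 : ℕ) / (1539 : ℕ) : ℝ) ≤ Real.logb 3 2 :=
    div_le_logb_of_pow_le (by norm_num) (by norm_num)
      (by exact_mod_cast (by decide +kernel : (3 : ℕ) ^ 971 ≤ 2 ^ 1539))
  have hexp : ((2 * 971 : ℕ) / (1026 : ℕ) : ℝ) ≤ 3 * Real.logb 3 2 := by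
    push_cast at hlog ⊢
    linarith
  have hpow : (1.266862 : ℚ) ^ 1026 ≤ (104 / 81) ^ 971 := by decide +kernel
  refine (le_rpow_div_of_pow_le (by positivity) (by norm_num) ?_).trans
    (Real.rpow_le_rpow_of_exponent_le one_le_two_mul_sqrt_div_nine hexp)
  rw [pow_mul, sq_two_mul_sqrt_div_nine]
  simpa only [Rat.cast_pow, Rat.cast_div, Rat.cast_ofScientific, Rat.cast_ofNat] using
    (Rat.cast_le (K := ℝ)).2 hpow

theorem two_mul_sqrt_div_nine_rpow_le : (2 * √26 / 9) ^ (3 * Real.logb 3 2) ≤ 1.3 := by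
  have hexp : 3 * Real.logb 3 2 ≤ (2 : ℕ) := by
    push_cast
    linarith [logb_three_two_le]
  refine (Real.rpow_le_rpow_of_exponent_le one_le_two_mul_sqrt_div_nine hexp).trans ?_
  rw [Real.rpow_natCast, sq_two_mul_sqrt_div_nine]
  norm_num

end ClosedForm

theorem mainTheorem1 :
    -- the lower bound
    ENNReal.ofReal ((2 * Real.sqrt 26 / 9) ^ (3 * Real.logb 3 2)) <
        MeasureTheory.Measure.hausdorffMeasure (cantorExponent 3) (cantorProduct 3) ∧
    -- numerical value of the closed form
    (1.266862 : ℝ) ≤ (2 * Real.sqrt 26 / 9) ^ (3 * Real.logb 3 2) ∧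
    -- the decimal lower bound on the measure
    ENNReal.ofReal 1.811621 <
        MeasureTheory.Measure.hausdorffMeasure (cantorExponent 3) (cantorProduct 3) ∧
    -- comparison with the planar product
    MeasureTheory.Measure.hausdorffMeasure (cantorExponent 2) (cantorProduct 2) <
        MeasureTheory.Measure.hausdorffMeasure (cantorExponent 3) (cantorProduct 3) := by
  have h : ∀ {r : ℝ}, r < 1.812 → ENNReal.ofReal r < μH[cantorExponent 3] (cantorProduct 3) :=
    fun hr => ((ENNReal.ofReal_lt_ofReal_iff (by norm_num)).2 hr).trans_le
      le_hausdorffMeasure_cantorProduct_three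
  refine ⟨h ?_, le_two_mul_sqrt_div_nine_rpow, h (by norm_num),
    (hausdorffMeasure_cantorProduct_le 2).trans_lt (h ?_)⟩
  · exact two_mul_sqrt_div_nine_rpow_le.trans_lt (by norm_num)
  · exact sqrt_two_rpow_cantorExponent_le.trans_lt (by norm_num)
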